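/- Let $d \ge 2$, $k \ge 1$ and $r \ge 0$ be integers with $(k,r) \ne (1,1)$, let $n = (r+1)(k-1)d+1$, and let $F_1, \ldots, F_n$ be finite subsets of $\mathbb{R}^d$ (the colour classes) with exactly $k$ points each. A point is regarded together with its colour, so the classes may overlap as subsets of $\mathbb{R}^d$. Then the coloured points can be partitioned into $k$ colourful sets $A_1, \ldots, A_k$, that is, one can choose points $x^i_j \in F_j$ ($1 \le i \le k$, $1 \le j \le n$) such that for each $j$ the points $x^1_j, \ldots, x^k_j$ are pairwise distinct, where $A_i$ consists of $x^i_1, \ldots, x^i_n$ with $x^i_j$ of colour $j$, with the following property. For every set $C \subseteq \{1, \ldots, n\}$ of exactly $r$ colours, the convex hulls of the sets $A_i \setminus C = \{x^i_j : j \notin C\}$ intersect with equal coefficients: there are real numbers $\alpha_j \ge 0$ ($j \notin C$) with $\sum_{j \notin C} \alpha_j = 1$ such that the point $\sum_{j \notin C} \alpha_j x^i_j$ is the same for all $i = 1, \ldots, k$. -/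

import Mathlib

open scoped BigOperators

/-- A colourful `k`-partition of the colour classes `F 0, …, F (n-1)` in `ℝ^d`, listed as
`A_i = {x i j : j}`, where `x i j` is the element of colour `j` in the `i`-th part: every part takes
exactly one point from every colour class, and distinct parts take distinct points of each class.
Points are regarded together with their colour, so the classes need not be disjoint as subsets
of `ℝ^d`. -/
structure IsColourfulPartition {d n k : ℕ} (F : Fin n → Finset (EuclideanSpace ℝ (Fin d)))
    (x : Fin k → Fin n → EuclideanSpace ℝ (Fin d)) : Prop where
  mem : ∀ i j, x i j ∈ F j
  disjoint : ∀ i i', i ≠ i' → ∀ j, x i j ≠ x i' j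

/-- The convex hulls of the sets `{x i j : j ∈ J}` (the parts restricted to the colours in `J`)
intersect with equal coefficients: one convex combination, indexed by the colours in `J`, yields
the same point `q` in every part. -/
def IntersectWithEqualCoefficients {d n k : ℕ}
    (x : Fin k → Fin n → EuclideanSpace ℝ (Fin d)) (J : Finset (Fin n)) : Prop :=
  ∃ α : Fin n → ℝ, (∀ j ∈ J, 0 ≤ α j) ∧ ∑ j ∈ J, α j = 1 ∧
    ∃ q : EuclideanSpace ℝ (Fin d), ∀ i, ∑ j ∈ J, α j • x i j = q

/-!
Identify each colour class with the finite group `G` of order `k`, centre it at its mean, and regard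
it as a vector of `G → E`. Its translates by `G` then sum to zero and span at most `(k - 1) * d`
dimensions, and a convex combination of one translate per colour vanishes exactly when the
corresponding parts have the same convex combination. It remains to choose the translates so that
the origin stays in their convex hull after any `r` deletions, a tolerant version of Bárány's
colourful Carathéodory theorem.

If no choice works, consider all convex hulls, over all choices and all small sets of deletions,
that miss the origin, and let `P` be their point nearest to it. Then `P` is a convex combination of
a set `I` of at most `(k - 1) * d` points. By induction some choice outside `I` has tolerance
`r - 1`, and so do all its `G`-translates. Keeping the points in `I`, each translate fails for some
set of at most `r` deletions; these all avoid `I`, so the failing hull contains `P` and, `P` being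
nearest, lies on the far side of a hyperplane through `P`. As the translates of a colour sum to
zero, they are not all on the far side, so the failing sets cover the complement of `I`, which has
too many elements.
-/

section Convexity

lemma norm_sq_le_inner_of_forall_norm_le {V : Type*} [NormedAddCommGroup V]
    [InnerProductSpace ℝ V] {K : Set V} (hK : Convex ℝ K) {P : V} (hP : P ∈ K)
    (hmin : ∀ y ∈ K, ‖P‖ ≤ ‖y‖) {y : V} (hy : y ∈ K) : ‖P‖ ^ 2 ≤ inner ℝ P y := by
  have : Nonempty K := ⟨⟨P, hP⟩⟩
  have hiInf : ‖0 - P‖ = ⨅ w : K, ‖0 - (w : V)‖ := by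
    simp only [zero_sub, norm_neg]
    exact le_antisymm (le_ciInf fun w => hmin w w.2)
      (ciInf_le (f := fun w : K => ‖(w : V)‖) ⟨0, by rintro _ ⟨w, rfl⟩; positivity⟩ ⟨P, hP⟩)
  have h := (norm_eq_iInf_iff_real_inner_le_zero hK hP).1 hiInf y hy
  rw [zero_sub, inner_neg_left, inner_sub_right, real_inner_self_eq_norm_sq] at h
  linarith

-- In Euclidean coordinates, `P` is the point of the union nearest to the origin and `ℓ = ⟪P, ·⟫`.
lemma exists_dual_supporting_convexHulls {W κ : Type*} [AddCommGroup W] [Module ℝ W]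
    [FiniteDimensional ℝ W] [Finite κ] {S : κ → Set W} (hfin : ∀ q, (S q).Finite)
    (hne : (⋃ q, convexHull ℝ (S q)).Nonempty) (h0 : ∀ q, 0 ∉ convexHull ℝ (S q)) :
    ∃ P ∈ ⋃ q, convexHull ℝ (S q), ∃ ℓ : Module.Dual ℝ W, 0 < ℓ P ∧
      ∀ q, P ∈ convexHull ℝ (S q) → ∀ y ∈ convexHull ℝ (S q), ℓ P ≤ ℓ y := by
  let φ : W ≃ₗ[ℝ] EuclideanSpace ℝ (Fin (Module.finrank ℝ W)) :=
    LinearEquiv.ofFinrankEq _ _ finrank_euclideanSpace_fin.symm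
  have himage : ∀ q, φ '' convexHull ℝ (S q) = convexHull ℝ (φ '' S q) := fun q =>
    φ.toLinearMap.image_convexHull (S q)
  have hcompact : IsCompact (φ '' ⋃ q, convexHull ℝ (S q)) := by
    rw [Set.image_iUnion]
    refine isCompact_iUnion fun q => ?_
    rw [himage]
    exact ((hfin q).image φ).isCompact_convexHull ℝ
  obtain ⟨_, ⟨P, hP, rfl⟩, hmin⟩ :=
    hcompact.exists_isMinOn (hne.image φ) continuous_norm.continuousOn
  refine ⟨P, hP, (innerₛₗ ℝ (φ P)).comp φ.toLinearMap, ?_, fun q hPq y hy => ?_⟩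
  · obtain ⟨q, hPq⟩ := Set.mem_iUnion.1 hP
    have hP0 : φ P ≠ 0 := φ.map_ne_zero_iff.2 fun h => h0 q (h ▸ hPq)
    exact real_inner_self_pos.2 hP0
  · have h := norm_sq_le_inner_of_forall_norm_le (himage q ▸ convex_convexHull ℝ _)
      (Set.mem_image_of_mem φ hPq) (fun z hz => hmin (Set.image_mono (Set.subset_iUnion _ q) hz))
      (Set.mem_image_of_mem φ hy)
    rwa [← real_inner_self_eq_norm_sq] at h

lemma linearIndependent_of_affineIndependent_of_dual_eq {𝕜 W κ : Type*} [Field 𝕜]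
    [AddCommGroup W] [Module 𝕜 W] {z : κ → W} (hz : AffineIndependent 𝕜 z)
    (ℓ : Module.Dual 𝕜 W) {c : 𝕜} (hc : c ≠ 0) (hℓ : ∀ i, ℓ (z i) = c) :
    LinearIndependent 𝕜 z := by
  rw [linearIndependent_iff']
  intro s v hv
  have hsum : ∑ i ∈ s, v i = 0 := by
    have h : ℓ (∑ i ∈ s, v i • z i) = 0 := by rw [hv, map_zero]
    simp only [map_sum, map_smul, hℓ, smul_eq_mul, ← Finset.sum_mul] at h
    exact (mul_eq_zero.1 h).resolve_right hc
  exact affineIndependent_iff.1 hz s v hsum hv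

-- A supporting hyperplane missing the origin saves one point over Carathéodory's theorem.
lemma exists_finset_card_le_finrank_mem_convexHull {𝕜 W ι : Type*} [Field 𝕜] [LinearOrder 𝕜]
    [IsStrictOrderedRing 𝕜] [AddCommGroup W] [Module 𝕜 W] {f : ι → W} {J : Finset ι} {P : W}
    (hP : P ∈ convexHull 𝕜 (f '' J)) (ℓ : Module.Dual 𝕜 W) (hP0 : ℓ P ≠ 0)
    (hℓ : ∀ i ∈ J, ℓ P ≤ ℓ (f i)) :
    ∃ I ⊆ J, I.card ≤ (f '' J).finrank 𝕜 ∧ P ∈ convexHull 𝕜 (f '' I) := by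
  classical
  obtain ⟨κ, _, z, w, hz, hind, hw, hw1, hsum⟩ := eq_pos_convex_span_of_mem_convexHull hP
  choose e heJ he using fun c => hz ⟨c, rfl⟩
  have hle : ∀ c, w c * ℓ P ≤ w c * ℓ (z c) := fun c =>
    mul_le_mul_of_nonneg_left (he c ▸ hℓ _ (heJ c)) (hw c).le
  have hsumℓ : ∑ c, w c * ℓ P = ∑ c, w c * ℓ (z c) := by
    rw [← Finset.sum_mul, hw1, one_mul, ← hsum]
    simp only [map_sum, map_smul, smul_eq_mul]
  have hface : ∀ c, ℓ (z c) = ℓ P := fun c =>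
    (mul_left_cancel₀ (hw c).ne'
      ((Finset.sum_eq_sum_iff_of_le fun c _ => hle c).1 hsumℓ c (Finset.mem_univ c))).symm
  have hlin := linearIndependent_of_affineIndependent_of_dual_eq hind ℓ hP0 hface
  refine ⟨Finset.univ.image e, Finset.image_subset_iff.2 fun c _ => heJ c, ?_, ?_⟩
  · have : FiniteDimensional 𝕜 (Submodule.span 𝕜 (f '' J)) :=
      FiniteDimensional.span_of_finite 𝕜 (J.finite_toSet.image f)
    calc (Finset.univ.image e).card ≤ Fintype.card κ := Finset.card_image_le
      _ = (Set.range z).finrank 𝕜 := (finrank_span_eq_card hlin).symm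
      _ ≤ (f '' J).finrank 𝕜 := Submodule.finrank_mono (Submodule.span_mono hz)
  · exact mem_convexHull_of_exists_fintype w z (fun c => (hw c).le) hw1
      (fun c => ⟨e c, by simp, he c⟩) hsum

lemma exists_weights_of_mem_convexHull_image {𝕜 W ι : Type*} [Field 𝕜] [LinearOrder 𝕜]
    [IsStrictOrderedRing 𝕜] [AddCommGroup W] [Module 𝕜 W] {f : ι → W} {J : Finset ι} {y : W}
    (hy : y ∈ convexHull 𝕜 (f '' J)) :
    ∃ α : ι → 𝕜, (∀ j, 0 ≤ α j) ∧ ∑ j ∈ J, α j = 1 ∧ ∑ j ∈ J, α j • f j = y := by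
  classical
  obtain ⟨κ, _, w, z, hw, hw1, hz, hsum⟩ := mem_convexHull_iff_exists_fintype.1 hy
  choose e heJ he using hz
  refine ⟨fun j => ∑ c with e c = j, w c, fun j => Finset.sum_nonneg fun c _ => hw c, ?_, ?_⟩
  · rw [Finset.sum_fiberwise_of_maps_to (fun c _ => heJ c), hw1]
  · rw [← hsum, ← Finset.sum_fiberwise_of_maps_to (g := e) (fun c _ => heJ c)]
    refine Finset.sum_congr rfl fun j _ => ?_
    rw [Finset.sum_smul]
    refine Finset.sum_congr rfl fun c hc => ?_
    rw [← (Finset.mem_filter.1 hc).2, he]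

end Convexity

section Tolerance

variable {W ι : Type*} [AddCommGroup W] [Module ℝ W] [DecidableEq ι]

/-- The points `f i`, `i ∈ J`, capture the origin with tolerance `s - 1`: the origin stays in their
convex hull when fewer than `s` of them are deleted. Counting with `<` makes `s = 0` vacuous, which
lets a single inductive step cover all tolerances. -/
def CapturesOrigin (f : ι → W) (J : Finset ι) (s : ℕ) : Prop :=
  ∀ C : Finset ι, C.card < s → 0 ∈ convexHull ℝ (f '' (J \ C : Finset ι))

lemma CapturesOrigin.map {V : Type*} [AddCommGroup V] [Module ℝ V] {f : ι → W} {J : Finset ι}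
    {s : ℕ} (h : CapturesOrigin f J s) (T : W →ₗ[ℝ] V) :
    CapturesOrigin (fun i => T (f i)) J s := by
  intro C hC
  have hT := Set.mem_image_of_mem T (h C hC)
  rwa [map_zero, LinearMap.image_convexHull, Set.image_image] at hT

lemma CapturesOrigin.subset_of_zero_notMem {f f' : ι → W} {J J' C : Finset ι} {s : ℕ}
    (h : CapturesOrigin f J' s) (hJ : J' ⊆ J) (hff' : ∀ i ∈ J', f i = f' i) (hC : C.card ≤ s)
    (h0 : 0 ∉ convexHull ℝ (f' '' (J \ C : Finset ι))) : C ⊆ J' := by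
  by_contra hsub
  have hlt : (C ∩ J').card < s := (Finset.card_lt_card
    (Finset.inter_subset_left.ssubset_of_ne fun he => hsub (Finset.inter_eq_left.1 he))).trans_le hC
  refine h0 (convexHull_mono ?_ (h _ hlt))
  rintro _ ⟨i, hi, rfl⟩
  obtain ⟨hiJ', hiC⟩ := Finset.mem_sdiff.1 (Finset.mem_coe.1 hi)
  refine ⟨i, Finset.mem_coe.2 (Finset.mem_sdiff.2 ⟨hJ hiJ', fun hi' => ?_⟩), (hff' i hiJ').symm⟩
  exact hiC (Finset.mem_inter.2 ⟨hi', hiJ'⟩)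

lemma exists_dual_pos_of_forall_not_capturesOrigin [FiniteDimensional ℝ W] [Finite ι] {γ : Type*}
    [Finite γ] [Nonempty γ] {f : γ → ι → W} {J : Finset ι} {s : ℕ} (hs : s ≤ J.card)
    (hf : ∀ c, ¬ CapturesOrigin (f c) J s) :
    ∃ c, ∃ I ⊆ J, I.card ≤ (f c '' J).finrank ℝ ∧
      ∃ P ∈ convexHull ℝ (f c '' I), ∃ ℓ : Module.Dual ℝ W, ∀ c' (C : Finset ι), C.card < s →
        0 ∉ convexHull ℝ (f c' '' (J \ C : Finset ι)) →
        P ∈ convexHull ℝ (f c' '' (J \ C : Finset ι)) → ∀ i ∈ J \ C, 0 < ℓ (f c' i) := by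
  let κ := {q : γ × Finset ι //
    q.2.card < s ∧ 0 ∉ convexHull ℝ (f q.1 '' (J \ q.2 : Finset ι))}
  let S : κ → Set W := fun q => f q.1.1 '' (J \ q.1.2 : Finset ι)
  have hne : (⋃ q, convexHull ℝ (S q)).Nonempty := by
    let c := Classical.arbitrary γ
    obtain ⟨C, hC, h0⟩ : ∃ C : Finset ι, C.card < s ∧
        0 ∉ convexHull ℝ (f c '' (J \ C : Finset ι)) := by
      simpa only [CapturesOrigin, not_forall, exists_prop] using hf c
    obtain ⟨i, hi⟩ := Finset.sdiff_nonempty_of_card_lt_card (hC.trans_le hs)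
    exact ⟨f c i, Set.mem_iUnion.2 ⟨⟨(c, C), hC, h0⟩, subset_convexHull ℝ _ ⟨i, hi, rfl⟩⟩⟩
  obtain ⟨P, hP, ℓ, hℓP, hℓ⟩ := exists_dual_supporting_convexHulls
    (fun q : κ => (Finset.finite_toSet _).image _) hne fun q => q.2.2
  obtain ⟨⟨⟨c, C⟩, hcC⟩, hPc⟩ := Set.mem_iUnion.1 hP
  obtain ⟨I, hIJ, hIcard, hPI⟩ := exists_finset_card_le_finrank_mem_convexHull hPc ℓ hℓP.ne'
    fun i hi => hℓ ⟨(c, C), hcC⟩ hPc _ (subset_convexHull ℝ _ ⟨i, hi, rfl⟩)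
  refine ⟨c, I, hIJ.trans Finset.sdiff_subset, hIcard.trans ?_, P, hPI, ℓ,
    fun c' C' hC' h0 hPC' i hi => ?_⟩
  · exact Set.finrank_mono (Set.image_mono (Finset.coe_subset.2 Finset.sdiff_subset))
  · exact hℓP.trans_le (hℓ ⟨(c', C'), hC', h0⟩ hPC' _ (subset_convexHull ℝ _ ⟨i, hi, rfl⟩))

end Tolerance

section Orbits

variable {G W ι : Type*} [Group G] [Fintype G] [AddCommGroup W] [Module ℝ W]
  [DistribMulAction G W]

lemma exists_dual_smul_nonpos {a : W} (ha : ∑ g : G, g • a = 0) (ℓ : Module.Dual ℝ W) (m : G) :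
    ∃ h : G, ℓ ((h * m) • a) ≤ 0 := by
  by_contra! hpos
  have hsum : ∑ h : G, (h * m) • a = 0 :=
    (Equiv.sum_comp (Equiv.mulRight m) fun h => h • a).trans ha
  have h := Finset.sum_pos (fun h _ => hpos h) Finset.univ_nonempty
  rw [← map_sum, hsum, map_zero] at h
  exact lt_irrefl _ h

variable [SMulCommClass G ℝ W] [DecidableEq ι] {a : ι → W}

lemma card_sdiff_le_of_forall_not_capturesOrigin (ha : ∀ i, ∑ g : G, g • a i = 0)
    {I J : Finset ι} (hIJ : I ⊆ J) {s : ℕ}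
    (hcon : ∀ g : ι → G, ¬ CapturesOrigin (fun i => g i • a i) J (s + 1)) {m : ι → G}
    (hm : CapturesOrigin (fun i => m i • a i) (J \ I) s) {g₀ : ι → G} {P : W}
    (hP : P ∈ convexHull ℝ ((fun i => g₀ i • a i) '' I)) {ℓ : Module.Dual ℝ W}
    (hℓ : ∀ (g : ι → G) (C : Finset ι), C.card < s + 1 →
      0 ∉ convexHull ℝ ((fun i => g i • a i) '' (J \ C : Finset ι)) →
      P ∈ convexHull ℝ ((fun i => g i • a i) '' (J \ C : Finset ι)) →
      ∀ i ∈ J \ C, 0 < ℓ (g i • a i)) :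
    (J \ I).card ≤ Fintype.card G * s := by
  let recolour : G → ι → G := fun h => I.piecewise g₀ fun i => h * m i
  have hrecolour : ∀ h, ∀ i ∈ J \ I, h • m i • a i = recolour h i • a i := fun h i hi => by
    rw [smul_smul]
    simp only [recolour, I.piecewise_eq_of_notMem _ _ (Finset.mem_sdiff.1 hi).2]
  simp only [CapturesOrigin, not_forall, exists_prop] at hcon
  choose C hCcard hC0 using fun h => hcon (recolour h)
  have hCsub : ∀ h, C h ⊆ J \ I := fun h =>
    (hm.map (DistribSMul.toLinearMap ℝ W h)).subset_of_zero_notMem Finset.sdiff_subset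
      (hrecolour h) (Nat.le_of_lt_succ (hCcard h)) (hC0 h)
  have hPC : ∀ h, P ∈ convexHull ℝ ((fun i => recolour h i • a i) '' (J \ C h : Finset ι)) := by
    refine fun h => convexHull_mono ?_ hP
    rintro _ ⟨i, hi, rfl⟩
    refine ⟨i, Finset.mem_coe.2 (Finset.mem_sdiff.2 ⟨hIJ hi, fun hi' => ?_⟩), ?_⟩
    · exact (Finset.mem_sdiff.1 (hCsub h hi')).2 hi
    · simp only [recolour, I.piecewise_eq_of_mem _ _ (Finset.mem_coe.1 hi)]
  have hcover : J \ I ⊆ Finset.univ.biUnion C := by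
    intro i hi
    obtain ⟨h, hh⟩ := exists_dual_smul_nonpos (ha i) ℓ (m i)
    rw [mul_smul, hrecolour h i hi] at hh
    by_contra hiC
    refine hh.not_gt (hℓ (recolour h) (C h) (hCcard h) (hC0 h) (hPC h) i (Finset.mem_sdiff.2
      ⟨(Finset.mem_sdiff.1 hi).1, fun hi' => hiC ?_⟩))
    exact Finset.mem_biUnion.2 ⟨h, Finset.mem_univ h, hi'⟩
  exact (Finset.card_le_card hcover).trans
    (Finset.card_biUnion_le_card_mul _ _ _ fun h _ => Nat.le_of_lt_succ (hCcard h))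

variable [FiniteDimensional ℝ W] [Finite ι]

lemma exists_capturesOrigin_succ (ha : ∀ i, ∑ g : G, g • a i = 0) {J : Finset ι} {s : ℕ}
    (hJ : (Set.range fun q : G × ι => q.1 • a q.2).finrank ℝ + Fintype.card G * s < J.card)
    (ih : ∀ I ⊆ J, I.card ≤ (Set.range fun q : G × ι => q.1 • a q.2).finrank ℝ →
      ∃ m : ι → G, CapturesOrigin (fun i => m i • a i) (J \ I) s) :
    ∃ g : ι → G, CapturesOrigin (fun i => g i • a i) J (s + 1) := by
  by_contra! hcon
  obtain ⟨g₀, I, hIJ, hIcard, P, hP, ℓ, hℓ⟩ :=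
    exists_dual_pos_of_forall_not_capturesOrigin (by nlinarith [Fintype.card_pos (α := G)]) hcon
  have hrange : (fun i => g₀ i • a i) '' J ⊆ Set.range fun q : G × ι => q.1 • a q.2 := by
    rintro _ ⟨i, -, rfl⟩
    exact ⟨(g₀ i, i), rfl⟩
  replace hIcard := hIcard.trans (Set.finrank_mono hrange)
  obtain ⟨m, hm⟩ := ih I hIJ hIcard
  have hcount := card_sdiff_le_of_forall_not_capturesOrigin ha hIJ hcon hm hP hℓ
  rw [Finset.card_sdiff_of_subset hIJ] at hcount
  omega

theorem exists_capturesOrigin_smul (ha : ∀ i, ∑ g : G, g • a i = 0) {p r : ℕ}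
    (hp : (Set.range fun q : G × ι => q.1 • a q.2).finrank ℝ ≤ p) {J : Finset ι}
    (hJ : p + r * max p (Fintype.card G) < J.card) :
    ∃ g : ι → G, CapturesOrigin (fun i => g i • a i) J (r + 1) := by
  have hG := le_max_right p (Fintype.card G)
  induction r generalizing J with
  | zero =>
    exact exists_capturesOrigin_succ ha (by omega) fun I _ _ =>
      ⟨1, fun C hC => absurd hC C.card.not_lt_zero⟩
  | succ r ih =>
    refine exists_capturesOrigin_succ ha ?_ fun I hIJ hI => ih ?_
    · nlinarith
    · rw [Finset.card_sdiff_of_subset hIJ]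
      have := le_max_left p (Fintype.card G)
      rw [add_one_mul] at hJ
      omega

end Orbits

section EqualCoefficients

/-- One convex combination, with coefficients indexed by `J`, gives the same point in every family
`x i`. This is `IntersectWithEqualCoefficients` for arbitrary real vector spaces and index types,
and unfolds to the same proposition for points of `EuclideanSpace ℝ (Fin d)`. -/
def HasCommonConvexCombination {κ ι E : Type*} [AddCommGroup E] [Module ℝ E] (x : κ → ι → E)
    (J : Finset ι) : Prop :=
  ∃ α : ι → ℝ, (∀ j ∈ J, 0 ≤ α j) ∧ ∑ j ∈ J, α j = 1 ∧ ∃ q : E, ∀ i, ∑ j ∈ J, α j • x i j = q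

lemma finrank_ker_sum_proj (𝕜 κ E : Type*) [Field 𝕜] [Fintype κ] [Nonempty κ] [AddCommGroup E]
    [Module 𝕜 E] [FiniteDimensional 𝕜 E] :
    Module.finrank 𝕜 (LinearMap.ker (∑ i, LinearMap.proj i : (κ → E) →ₗ[𝕜] E)) =
      (Fintype.card κ - 1) * Module.finrank 𝕜 E := by
  classical
  have hsurj : LinearMap.range (∑ i, LinearMap.proj i : (κ → E) →ₗ[𝕜] E) = ⊤ :=
    LinearMap.range_eq_top.2 fun y => ⟨Pi.single (Classical.arbitrary κ) y, by simp⟩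
  have h := LinearMap.finrank_range_add_finrank_ker (∑ i, LinearMap.proj i : (κ → E) →ₗ[𝕜] E)
  rw [hsurj, finrank_top, Module.finrank_pi_fintype, Finset.sum_const, Finset.card_univ,
    smul_eq_mul] at h
  rw [Nat.sub_mul, one_mul]
  omega

variable {E ι : Type*} [AddCommGroup E] [Module ℝ E] [FiniteDimensional ℝ E] [Fintype ι]
  [DecidableEq ι]

theorem exists_translates_hasCommonConvexCombination {G : Type*} [Group G] [Fintype G]
    (x : ι → G → E) {r : ℕ} (hι : (Fintype.card G - 1) * Module.finrank ℝ E +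
      r * max ((Fintype.card G - 1) * Module.finrank ℝ E) (Fintype.card G) < Fintype.card ι) :
    ∃ g : ι → G, ∀ C : Finset ι, C.card ≤ r →
      HasCommonConvexCombination (fun h j => x j (g j * h)) (Finset.univ \ C) := by
  let mean : ι → E := fun j => (Fintype.card G : ℝ)⁻¹ • ∑ h, x j h
  let a : ι → G → E := fun j h => x j h - mean j
  have hsum : ∀ j, ∑ h, a j h = 0 := fun j => by
    have hG : (Fintype.card G : ℝ) ≠ 0 := Nat.cast_ne_zero.2 Fintype.card_ne_zero
    simp only [a, mean, Finset.sum_sub_distrib, Finset.sum_const, Finset.card_univ,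
      ← Nat.cast_smul_eq_nsmul ℝ, smul_inv_smul₀ hG, sub_self]
  let : Fintype Gᵈᵐᵃ := Fintype.ofEquiv G DomMulAct.mk
  have horbit : ∀ j, ∑ g : Gᵈᵐᵃ, g • a j = 0 := fun j => by
    ext h
    rw [Finset.sum_apply, ← Equiv.sum_comp DomMulAct.mk]
    exact (Equiv.sum_comp (Equiv.mulRight h) (a j)).trans (hsum j)
  have hfinrank : (Set.range fun q : Gᵈᵐᵃ × ι => q.1 • a q.2).finrank ℝ ≤
      (Fintype.card G - 1) * Module.finrank ℝ E := by
    rw [← finrank_ker_sum_proj ℝ G E]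
    refine Submodule.finrank_mono (Submodule.span_le.2 ?_)
    rintro _ ⟨⟨g, j⟩, rfl⟩
    rw [SetLike.mem_coe, LinearMap.mem_ker, LinearMap.sum_apply]
    exact (Equiv.sum_comp (Equiv.mulLeft (DomMulAct.mk.symm g)) (a j)).trans (hsum j)
  obtain ⟨g, hg⟩ := exists_capturesOrigin_smul (J := Finset.univ) (r := r) horbit hfinrank
    (by rwa [Fintype.card_congr DomMulAct.mk.symm, Finset.card_univ])
  refine ⟨fun j => DomMulAct.mk.symm (g j), fun C hC => ?_⟩
  obtain ⟨α, hα, hα1, hα0⟩ := exists_weights_of_mem_convexHull_image (hg C (Nat.lt_succ_of_le hC))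
  refine ⟨α, fun j _ => hα j, hα1, ∑ j ∈ Finset.univ \ C, α j • mean j, fun h => ?_⟩
  have hα0h : ∑ j ∈ Finset.univ \ C, α j • (x j (DomMulAct.mk.symm (g j) * h) - mean j) = 0 := by
    rw [← Pi.zero_apply (M := fun _ => E) h, ← hα0, Finset.sum_apply]
    rfl
  simpa only [smul_sub, Finset.sum_sub_distrib, sub_eq_zero] using hα0h

lemma add_min_mul_max_lt {k d r n : ℕ} (hk : 1 ≤ k)
    (hn : (k - 1) * (d + r * max d 2) < n) :
    (k - 1) * d + min r (n - 1) * max ((k - 1) * d) k < n := by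
  rcases hk.eq_or_lt with rfl | hk2
  · have := min_le_right r (n - 1)
    simp only [Nat.sub_self, zero_mul, zero_add, Nat.max_eq_right zero_le_one, mul_one] at hn ⊢
    omega
  · have hmax : max ((k - 1) * d) k ≤ (k - 1) * max d 2 :=
      max_le (Nat.mul_le_mul_left _ (le_max_left d 2))
        ((by omega : k ≤ (k - 1) * 2).trans (Nat.mul_le_mul_left _ (le_max_right d 2)))
    calc (k - 1) * d + min r (n - 1) * max ((k - 1) * d) k
        ≤ (k - 1) * d + r * ((k - 1) * max d 2) := by gcongr; exact min_le_left _ _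
      _ = (k - 1) * (d + r * max d 2) := by ring
      _ < n := hn

-- The `2` makes `(k - 1) * max d 2 ≥ k` for `k ≥ 2`: the covering argument needs `k` further
-- colours for each additional deletion.
theorem theorem2_general {k r : ℕ} (hk : 1 ≤ k)
    (hι : (k - 1) * (Module.finrank ℝ E + r * max (Module.finrank ℝ E) 2) < Fintype.card ι)
    (F : ι → Finset E) (hF : ∀ j, (F j).card = k) :
    ∃ x : Fin k → ι → E, (∀ i j, x i j ∈ F j) ∧ (∀ j, Function.Injective fun i => x i j) ∧
      ∀ C : Finset ι, C.card ≤ r → C ≠ Finset.univ →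
        HasCommonConvexCombination x (Finset.univ \ C) := by
  have : NeZero k := ⟨by omega⟩
  let e : ∀ j, Fin k ≃ F j := fun j => ((F j).equivFinOfCardEq (hF j)).symm
  obtain ⟨g, hg⟩ := exists_translates_hasCommonConvexCombination (G := Multiplicative (Fin k))
    (r := min r (Fintype.card ι - 1)) (fun j h => (e j h.toAdd : E)) (by
      rw [Fintype.card_multiplicative, Fintype.card_fin]
      exact add_min_mul_max_lt hk hι)
  refine ⟨fun i j => e j ((g j).toAdd + i), fun i j => (e j _).2, fun j => ?_, fun C hC hne => ?_⟩
  · exact Subtype.val_injective.comp ((e j).injective.comp (add_right_injective _))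
  · obtain ⟨α, hα, hα1, q, hq⟩ := hg C (le_min hC (Nat.le_sub_one_of_lt
      ((Finset.card_lt_iff_ne_univ C).2 hne)))
    exact ⟨α, hα, hα1, q, fun i => hq (Multiplicative.ofAdd i)⟩

end EqualCoefficients

lemma card_ne_tolerance {d k r : ℕ} (hd : 2 ≤ d) (hk : 1 ≤ k) (hkr : ¬ (k = 1 ∧ r = 1)) :
    (r + 1) * (k - 1) * d + 1 ≠ r := by
  rcases hk.eq_or_lt with rfl | hk2
  · simpa [eq_comm] using hkr
  · have := Nat.le_mul_of_pos_right (r + 1) (Nat.sub_pos_of_lt hk2)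
    nlinarith

theorem theorem2 (d k r n : ℕ) (hd : 2 ≤ d) (hk : 1 ≤ k) (hkr : ¬ (k = 1 ∧ r = 1))
    (hn : n = (r + 1) * (k - 1) * d + 1)
    (F : Fin n → Finset (EuclideanSpace ℝ (Fin d))) (hF : ∀ j, (F j).card = k) :
    ∃ x : Fin k → Fin n → EuclideanSpace ℝ (Fin d),
      IsColourfulPartition F x ∧
        ∀ C : Finset (Fin n), C.card = r →
          IntersectWithEqualCoefficients x (Finset.univ \ C) := by
  obtain ⟨x, hmem, hinj, hx⟩ := theorem2_general (r := r) hk (by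
    rw [finrank_euclideanSpace_fin, Fintype.card_fin, max_eq_left hd, hn]
    linarith) F hF
  exact ⟨x, ⟨hmem, fun i i' hi j => (hinj j).ne hi⟩, fun C hC => hx C hC.le fun hCuniv =>
    card_ne_tolerance hd hk hkr (by rw [← hn, ← hC, hCuniv, Finset.card_fin])⟩
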